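/- Let $d\ge 3$, let $\Gamma=\mathbb Z^d$, and let $\Gamma^*=(\mathbb R/2\pi\mathbb Z)^d$ with its normalized Haar measure $\mu^*$. Let $\mathfrak e\in C^2(\Gamma^*,\mathbb R)$ be a Morse function (every critical point is non-degenerate) with $\min\mathfrak e=0$, and let $V:\Gamma\to[0,\infty)$ satisfy $V\in\ell^{d/2}(\Gamma)$. Let $\mathcal F^*:\ell^2(\Gamma)\to L^2(\Gamma^*,\mu^*)$, $[\mathcal F^*\varphi](p)=\sum_{x\in\Gamma}e^{-i\langle p,x\rangle}\varphi(x)$, be the discrete Fourier transformation, with inverse $\mathcal F$, and let $h(\mathfrak e)=\mathcal F\,\mathfrak e\,\mathcal F^*$ be the Fourier multiplier on $\ell^2(\Gamma)$ with symbol $\mathfrak e$. For a bounded potential $W:\Gamma\to[0,\infty)$ put $$H(\mathfrak e,W)=h(\mathfrak e)-W(x)\ \text{ on } \ell^2(\Gamma),\qquad N[\mathfrak e,W]=\operatorname{Tr}\{\mathbf 1[H(\mathfrak e,W)<0]\},$$ the number of negative eigenvalues of $H(\mathfrak e,W)$ counted with multiplicity, and $$N_{sc}[\mathfrak e,W]=\sum_{x\in\Gamma}\int_{\Gamma^*}\mathbf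 1[\mathfrak e(p)-W(x)<0]\,d\mu^*(p).$$ Then $$\lim_{\lambda\to\infty}\lambda^{-d/2}N[\mathfrak e,\lambda V]=\lim_{\lambda\to\infty}\lambda^{-d/2}N_{sc}[\mathfrak e,\lambda V]=0 .$$ -/

import Mathlib

open scoped ENNReal Topology
open MeasureTheory Filter

noncomputable section

namespace LatticeSchrodinger

/-! ## The lattice and its dual torus -/

/-- The hypercubic lattice `Γ = ℤ^d`. -/
abbrev Lattice (d : ℕ) : Type := Fin d → ℤ

/-- The Hilbert space `ℓ²(Γ)` of complex square-summable functions on the lattice. -/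
abbrev LTwo (d : ℕ) : Type := lp (fun _ : Lattice d => ℂ) 2

instance fact_two_pi_pos : Fact (0 < 2 * Real.pi) := ⟨Real.two_pi_pos⟩

/-- The dual group `Γ* = (ℝ / 2πℤ)^d` (the Brillouin zone). -/
abbrev DualTorus (d : ℕ) : Type := Fin d → AddCircle (2 * Real.pi)

/-- The normalized Haar measure `μ*` on `Γ*`, i.e. `dμ*(p) = d^d p / (2π)^d`. -/
def dualHaar (d : ℕ) : Measure (DualTorus d) :=
  Measure.pi fun _ => AddCircle.haarAddCircle

instance (d : ℕ) : IsProbabilityMeasure (dualHaar d) := by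
  unfold dualHaar; infer_instance

/-! ## Admissible dispersion relations -/

/-- A function on the torus, read as a `2π`-periodic function on `ℝ^d`. -/
def periodicLift {d : ℕ} (e : DualTorus d → ℝ) : (Fin d → ℝ) → ℝ :=
  fun p => e fun i => (p i : AddCircle (2 * Real.pi))

/-- `e` is an admissible dispersion relation: a `C²` Morse function on the torus `Γ*` (every
critical point is non-degenerate) whose minimum is `0`. -/
structure IsAdmissible {d : ℕ} (e : C(DualTorus d, ℝ)) : Prop where
  contDiff : ContDiff ℝ 2 (periodicLift e)
  /-- At each critical point the Hessian is a non-degenerate bilinear form. -/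
  morse : ∀ p, fderiv ℝ (periodicLift e) p = 0 →
    ∀ v, (∀ w, fderiv ℝ (fderiv ℝ (periodicLift e)) p v w = 0) → v = 0
  isLeast_zero : IsLeast (Set.range e) 0

/-! ## The discrete Fourier transformation -/

section Fourier

variable {d : ℕ}

/-- The character `p ↦ exp (i ⟨p, x⟩)` of `Γ*` given by `x ∈ Γ`. -/
def character (x : Lattice d) : C(DualTorus d, ℂ) where
  toFun p := ∏ i, fourier (x i) (p i)
  continuous_toFun := by fun_prop

/-- The formula for the character at (the class of) a point `p ∈ ℝ^d`. -/
theorem character_coe (x : Lattice d) (p : Fin d → ℝ) :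
    character x (fun i => (p i : AddCircle (2 * Real.pi))) =
      Complex.exp (Complex.I * ∑ i, (p i : ℂ) * (x i : ℂ)) := by
  simp only [character, ContinuousMap.coe_mk, fourier_coe_apply, Finset.mul_sum, Complex.exp_sum]
  refine Finset.prod_congr rfl fun i _ => ?_
  congr 1
  have : (Real.pi : ℂ) ≠ 0 := by exact_mod_cast Real.pi_ne_zero
  push_cast
  field_simp

theorem character_neg (x : Lattice d) (p : DualTorus d) :
    character (-x) p = (starRingEnd ℂ) (character x p) := by
  simp [character]

theorem character_add (x y : Lattice d) (p : DualTorus d) :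
    character (x + y) p = character x p * character y p := by
  simp [character, Finset.prod_mul_distrib]

theorem character_zero : character (0 : Lattice d) = 1 := by
  ext p; simp [character]

theorem character_single [DecidableEq (Fin d)] (i : Fin d) (p : DualTorus d) :
    character (Pi.single i 1) p = fourier 1 (p i) := by
  simp only [character, ContinuousMap.coe_mk]
  rw [Finset.prod_eq_single i]
  · simp
  · intro j _ hj
    simp [Pi.single_eq_of_ne hj]
  · simp

/-- The star subalgebra of `C(Γ*, ℂ)` generated by the characters. -/
def characterSubalgebra (d : ℕ) : StarSubalgebra ℂ C(DualTorus d, ℂ) where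
  toSubalgebra := Algebra.adjoin ℂ (Set.range character)
  star_mem' := by
    change Algebra.adjoin ℂ (Set.range character) ≤ star (Algebra.adjoin ℂ (Set.range character))
    refine Algebra.adjoin_le ?_
    rintro _ ⟨n, rfl⟩
    refine Algebra.subset_adjoin ⟨-n, ?_⟩
    ext1 x
    simp only [character_neg, starRingEnd_apply, ContinuousMap.star_apply]

theorem characterSubalgebra_coe :
    (characterSubalgebra d).toSubalgebra.toSubmodule =
      Submodule.span ℂ (Set.range character) := by
  apply Algebra.adjoin_eq_span_of_subset
  refine .trans (fun x => Submonoid.closure_induction (fun _ => id) ⟨0, ?_⟩ ?_)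
    Submodule.subset_span
  · exact character_zero
  · rintro _ _ _ _ ⟨m, rfl⟩ ⟨n, rfl⟩
    exact ⟨m + n, by ext z; simp [character_add]⟩

theorem characterSubalgebra_separatesPoints :
    (characterSubalgebra d).SeparatesPoints := by
  classical
  intro x y hxy
  rw [Ne, funext_iff, not_forall] at hxy
  obtain ⟨i, hi⟩ := hxy
  refine ⟨_, ⟨character (Pi.single i 1), Algebra.subset_adjoin ⟨Pi.single i 1, rfl⟩, rfl⟩, ?_⟩
  dsimp only
  rw [character_single, character_single, fourier_one, fourier_one]
  contrapose hi
  exact AddCircle.injective_toCircle Real.two_pi_pos.ne' (Circle.coe_injective hi)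

theorem span_character_closure_eq_top :
    (Submodule.span ℂ (Set.range (character (d := d)))).topologicalClosure = ⊤ := by
  rw [← characterSubalgebra_coe]
  exact congr_arg (Subalgebra.toSubmodule <| StarSubalgebra.toSubalgebra ·)
    (ContinuousMap.starSubalgebra_topologicalClosure_eq_top_of_separatesPoints _
      characterSubalgebra_separatesPoints)

/-- The function `p ↦ exp (-i ⟨p, x⟩)` as an element of `L²(Γ*, μ*)`. -/
def planeWave (x : Lattice d) : Lp ℂ 2 (dualHaar d) :=
  ContinuousMap.toLp (E := ℂ) 2 (dualHaar d) ℂ (character (-x))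

theorem orthonormal_planeWave : Orthonormal ℂ (planeWave (d := d)) := by
  rw [orthonormal_iff_ite]
  intro m n
  simp only [planeWave, ContinuousMap.inner_toLp, ← character_neg, ← character_add]
  split_ifs with h
  · simp [h, character_zero]
  · simp only [character, ContinuousMap.coe_mk, dualHaar]
    rw [integral_fintype_prod_eq_prod (f := fun i t => fourier ((-n + - -m) i) t)]
    obtain ⟨i, hi⟩ := Function.ne_iff.mp h
    apply Finset.prod_eq_zero (Finset.mem_univ i)
    have := (orthonormal_iff_ite.mp <| orthonormal_fourier (T := 2 * Real.pi)) (-m i) (-n i)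
    simpa [hi, ContinuousMap.inner_toLp, ← fourier_neg, ← fourier_add] using this

theorem span_planeWave_closure_eq_top :
    (Submodule.span ℂ (Set.range (planeWave (d := d)))).topologicalClosure = ⊤ := by
  have h : Set.range (planeWave (d := d)) =
      Set.range fun x => ContinuousMap.toLp (E := ℂ) 2 (dualHaar d) ℂ (character x) := by
    ext f
    constructor
    · rintro ⟨x, rfl⟩; exact ⟨-x, rfl⟩
    · rintro ⟨x, rfl⟩; exact ⟨-x, by simp [planeWave]⟩
  rw [h]
  simpa only [Submodule.map_span, ContinuousLinearMap.coe_coe, ← Set.range_comp,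
    Function.comp_def] using
    (ContinuousMap.toLp_denseRange ℂ (dualHaar d) ℂ (p := 2)
      (by simp)).topologicalClosure_map_submodule span_character_closure_eq_top

/-- The functions `p ↦ exp (-i ⟨p, x⟩)`, `x ∈ Γ`, form a Hilbert basis of `L²(Γ*, μ*)`. -/
def planeWaveBasis (d : ℕ) : HilbertBasis (Lattice d) ℂ (Lp ℂ 2 (dualHaar d)) :=
  HilbertBasis.mk orthonormal_planeWave span_planeWave_closure_eq_top.ge

/-- The discrete Fourier transformation `𝓕* : ℓ²(Γ) → L²(Γ*, μ*)`,
`(𝓕* φ)(p) = ∑ x, exp (-i ⟨p, x⟩) φ(x)` (convergence in `L²`). Its inverse is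
`(𝓕 ψ)(x) = ∫ exp (i ⟨p, x⟩) ψ(p) dμ*(p)`. -/
def fourierStar (d : ℕ) : LTwo d ≃ₗᵢ[ℂ] Lp ℂ 2 (dualHaar d) :=
  (planeWaveBasis d).repr.symm

end Fourier

/-! ## The operators -/

section Operators

variable {d : ℕ}

/-- A real continuous function on `Γ*` as an element of `L^∞(Γ*, μ*; ℂ)`. -/
def toLInfty (e : C(DualTorus d, ℝ)) : Lp ℂ ∞ (dualHaar d) :=
  ContinuousMap.toLp (E := ℂ) ∞ (dualHaar d) ℂ
    ((⟨fun t : ℝ => (t : ℂ), Complex.continuous_ofReal⟩ : C(ℝ, ℂ)).comp e)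

/-- Multiplication by `e` on `L²(Γ*, μ*)`. -/
def torusMul (e : C(DualTorus d, ℝ)) : Lp ℂ 2 (dualHaar d) →L[ℂ] Lp ℂ 2 (dualHaar d) :=
  (ContinuousLinearMap.mul ℂ ℂ).holderL (dualHaar d) ∞ 2 2 (toLInfty e)

/-- The hopping matrix `h(e) = 𝓕 e 𝓕*` on `ℓ²(Γ)`: the Fourier multiplier with symbol `e`. -/
def hopping (e : C(DualTorus d, ℝ)) : LTwo d →L[ℂ] LTwo d :=
  (fourierStar d).symm.toContinuousLinearEquiv.toContinuousLinearMap ∘L torusMul e ∘L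
    (fourierStar d).toContinuousLinearEquiv.toContinuousLinearMap

open Classical in
/-- The multiplication operator `φ ↦ V φ` on `ℓ²(Γ)` of a bounded potential `V` (and `0`, by
convention, if `V` is unbounded; potentials in `ℓ^q(Γ)` are always bounded). -/
def potentialMul (V : Lattice d → ℝ) : LTwo d →L[ℂ] LTwo d :=
  if h : ∃ K : ℝ, 0 ≤ K ∧ ∀ x, ‖(V x : ℂ) • ContinuousLinearMap.id ℂ ℂ‖ ≤ K then
    lp.mapCLM 2 (fun x => (V x : ℂ) • ContinuousLinearMap.id ℂ ℂ) h.choose_spec.1 h.choose_spec.2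
  else 0

/-- The discrete Schrödinger operator `H(e, V) = h(e) - V` on `ℓ²(Γ)`. -/
def schrodinger (e : C(DualTorus d, ℝ)) (V : Lattice d → ℝ) : LTwo d →L[ℂ] LTwo d :=
  hopping e - potentialMul V

/-- The defining property of the hopping matrix: `(𝓕* (h(e) φ))(p) = e(p) (𝓕* φ)(p)`. -/
theorem fourierStar_hopping (e : C(DualTorus d, ℝ)) (φ : LTwo d) :
    fourierStar d (hopping e φ) =ᵐ[dualHaar d] fun p => (e p : ℂ) * fourierStar d φ p := by
  have h1 : fourierStar d (hopping e φ) = torusMul e (fourierStar d φ) := by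
    simp [hopping]
  rw [h1]
  have h2 := ContinuousLinearMap.coeFn_holder (r := 2) (ContinuousLinearMap.mul ℂ ℂ)
    (toLInfty e) (fourierStar d φ)
  have h3 := ContinuousMap.coeFn_toLp (p := ∞) (𝕜 := ℂ) (dualHaar d)
    ((⟨fun t : ℝ => (t : ℂ), Complex.continuous_ofReal⟩ : C(ℝ, ℂ)).comp e)
  filter_upwards [h2, h3] with p hp hp'
  simp only [torusMul, ContinuousLinearMap.holderL_apply_apply]
  rw [hp]
  simp only [toLInfty, hp']
  simp

theorem potentialMul_apply {V : Lattice d → ℝ} (hV : Memℓp V ∞) (φ : LTwo d) (x : Lattice d) :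
    potentialMul V φ x = (V x : ℂ) * φ x := by
  have h : ∃ K : ℝ, 0 ≤ K ∧ ∀ x, ‖(V x : ℂ) • ContinuousLinearMap.id ℂ ℂ‖ ≤ K := by
    obtain ⟨K, hK⟩ := memℓp_infty_iff.mp hV
    refine ⟨max K 0, le_max_right _ _, fun x => ?_⟩
    have := hK ⟨x, rfl⟩
    simp only at this
    rw [norm_smul]
    simpa using Or.inl this
  simp [potentialMul, dif_pos h]

theorem isSelfAdjoint_potentialMul (V : Lattice d → ℝ) : IsSelfAdjoint (potentialMul V) := by
  rw [ContinuousLinearMap.isSelfAdjoint_iff_isSymmetric]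
  intro φ ψ
  unfold potentialMul
  split_ifs with h
  · simp only [ContinuousLinearMap.coe_coe, lp.inner_eq_tsum]
    refine tsum_congr fun x => ?_
    simp [lp.mapCLM]
    ring
  · simp

theorem isSelfAdjoint_hopping (e : C(DualTorus d, ℝ)) : IsSelfAdjoint (hopping e) := by
  rw [ContinuousLinearMap.isSelfAdjoint_iff_isSymmetric]
  intro φ ψ
  simp only [ContinuousLinearMap.coe_coe]
  rw [← (fourierStar d).inner_map_map (hopping e φ), ← (fourierStar d).inner_map_map φ,
    L2.inner_def, L2.inner_def]
  refine integral_congr_ae ?_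
  filter_upwards [fourierStar_hopping e φ, fourierStar_hopping e ψ] with p h1 h2
  rw [h1, h2]
  simp
  ring

theorem isSelfAdjoint_schrodinger (e : C(DualTorus d, ℝ)) (V : Lattice d → ℝ) :
    IsSelfAdjoint (schrodinger e V) :=
  (isSelfAdjoint_hopping e).sub (isSelfAdjoint_potentialMul V)

end Operators

/-! ## Counting functions -/

/-- The spectral subspace `Ran 1[A < 0]` of a bounded self-adjoint operator `A`. In terms of the
negative part `A⁻ = max (-A) 0` (continuous functional calculus), the spectral projection
`1[A < 0]` is the orthogonal projection onto the closure of the range of `A⁻`. -/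
def negSpectralSubspace {E : Type*} [NormedAddCommGroup E] [InnerProductSpace ℂ E]
    [CompleteSpace E] (A : E →L[ℂ] E) : Submodule ℂ E :=
  (LinearMap.range (A⁻).toLinearMap).topologicalClosure

/-- `Tr 1[A < 0]`, the number of negative eigenvalues of a bounded self-adjoint operator `A`
counted with multiplicity: the dimension of `Ran 1[A < 0]` (in particular `∞` if `A` has negative
essential spectrum). -/
def numNegative {E : Type*} [NormedAddCommGroup E] [InnerProductSpace ℂ E]
    [CompleteSpace E] (A : E →L[ℂ] E) : ℕ∞ :=
  Cardinal.toENat (Module.rank ℂ (negSpectralSubspace A))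

/-- The number `N[e, V] = Tr 1[H(e, V) < 0]` of bound states. -/
def boundStates {d : ℕ} (e : C(DualTorus d, ℝ)) (V : Lattice d → ℝ) : ℕ∞ :=
  numNegative (schrodinger e V)

/-- The semi-classical number of bound states
`N_sc[e, V] = ∑ x, ∫ 1[e(p) - V(x) < 0] dμ*(p)`. -/
def semiclassicalStates {d : ℕ} (e : C(DualTorus d, ℝ)) (V : Lattice d → ℝ) : ℝ≥0∞ :=
  ∑' x : Lattice d, ∫⁻ p, Set.indicator {p | e p - V x < 0} (fun _ => (1 : ℝ≥0∞)) p ∂(dualHaar d)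

end LatticeSchrodinger

end

open LatticeSchrodinger

/-! Both counting functions, for a potential `W`, are at most `|S| + C ∑_{x ∉ S} W(x)^(d/2)` for
every finite set `S`: on a lattice, finitely many sites carry at most `|S|` states, however deep the
wells. With `W = λV`, multiplying by `λ^(-d/2)` makes the first term vanish as `λ → ∞` and leaves a
tail of the convergent sum of `V^(d/2)`, which is small once `S` is large
(`tendsto_rpow_neg_mul_of_le`).

The quantum bound (`boundStates_le`) is of Cwikel–Lieb–Rozenblum type. Non-degenerate minima give
`μ*{e ≤ t} = O(t^(d/2))`, and since `d/2 > 1` also `∫_{e ≤ t} 1/e = O(t^(d/2-1))`. On the negative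
spectral subspace the energy `‖√e 𝓕*u‖²` is at most `∑ W|u|²`. Take `n` functions vanishing on `S`
and orthonormal in energy, so that `n ≤ ∑ₓ W(x) ∑ⱼ |uⱼ(x)|²`, and cut each `uⱼ(x)` at an energy
comparable to `W(x)`. Bessel's inequality bounds the low part by the phase space integral
(`sum_enorm_inner_low_sq_le`). The high parts, summed over all sites and dyadic energies, cost at
most a multiple of the total energy `n` (`tsum_tsum_enorm_inner_high_sq_le`). The constants leave
`n/2`, which is absorbed on the left. -/

open LatticeSchrodinger

/-! ### Quadratic growth at non-degenerate minima -/

section Coercivity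

variable {E : Type*} [NormedAddCommGroup E] [NormedSpace ℝ E]

/-- Second order Taylor expansion of a `C²` function at a critical point. -/
theorem eventually_abs_sub_hessian_le {f : E → ℝ} (hf : ContDiff ℝ 2 f) {a : E}
    (ha : fderiv ℝ f a = 0) {ε : ℝ} (hε : 0 < ε) :
    ∀ᶠ x in 𝓝 a, |f x - f a - (1 / 2) * fderiv ℝ (fderiv ℝ f) a (x - a) (x - a)|
      ≤ ε * ‖x - a‖ ^ 2 := by
  set B := fderiv ℝ (fderiv ℝ f) a with hB
  have hsymm : ∀ v w, B v w = B w v := by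
    have : IsSymmSndFDerivAt ℝ f a := hf.contDiffAt.isSymmSndFDerivAt (by simp)
    exact fun v w => this v w
  have hf1 : Differentiable ℝ f := hf.differentiable (by norm_num)
  have hf2 : DifferentiableAt ℝ (fderiv ℝ f) a :=
    ((hf.fderiv_right (m := 1) (by norm_num)).differentiable (by norm_num)) a
  have h1 := hf2.hasFDerivAt.isLittleO.def hε
  rw [ha] at h1
  obtain ⟨δ, hδ, hball⟩ := Metric.eventually_nhds_iff_ball.1 h1
  filter_upwards [Metric.ball_mem_nhds a hδ] with x hx
  -- Without its quadratic part, `f` has derivative `o(‖y - a‖)`; the mean value inequality on the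
  -- ball of radius `‖x - a‖` then gives the bound.
  set g : E → ℝ := fun y => f y - (1 / 2) * B (y - a) (y - a) with hg
  have hder : ∀ y, HasFDerivAt g (fderiv ℝ f y - B (y - a)) y := by
    intro y
    have e1 : HasFDerivAt (fun y : E => y - a) (ContinuousLinearMap.id ℝ E) y :=
      (hasFDerivAt_id y).sub_const a
    have e2 := (B.hasFDerivAt.comp y e1).clm_apply e1
    have e3 := (hf1 y).hasFDerivAt.sub (e2.const_mul (1 / 2 : ℝ))
    refine e3.congr_fderiv ?_
    ext w
    have := hsymm w (y - a)
    simp only [FunLike.coe_sub, Pi.sub_apply, FunLike.coe_smul, Pi.smul_apply,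
      add_apply, ContinuousLinearMap.comp_apply, ContinuousLinearMap.flip_apply, smul_eq_mul,
      ContinuousLinearMap.id_apply, Function.comp_apply, this]
    ring
  have hconv : Convex ℝ (Metric.closedBall a ‖x - a‖) := convex_closedBall _ _
  have := hconv.norm_image_sub_le_of_norm_hasFDerivWithin_le (f := g)
    (f' := fun y => fderiv ℝ f y - B (y - a)) (C := ε * ‖x - a‖) (x := a) (y := x)
    (fun y _ => (hder y).hasFDerivWithinAt) (fun y hy => ?_)
    (Metric.mem_closedBall_self (norm_nonneg _)) (by simp [dist_eq_norm])
  · have h2 : g x - g a = f x - f a - 1 / 2 * B (x - a) (x - a) := by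
      simp [hg]; ring
    rw [h2, Real.norm_eq_abs] at this
    calc _ ≤ _ := this
      _ = _ := by ring
  · rw [Metric.mem_closedBall, dist_eq_norm] at hy
    rw [Metric.mem_ball, dist_eq_norm] at hx
    have := hball y (by rw [Metric.mem_ball, dist_eq_norm]; exact hy.trans_lt hx)
    rw [sub_zero] at this
    exact this.trans (by gcongr)

/-- The Hessian of a `C²` function at a local minimum is positive semidefinite. -/
theorem hessian_nonneg_of_isLocalMin {f : E → ℝ} (hf : ContDiff ℝ 2 f) {a : E}
    (ha : IsLocalMin f a) (v : E) : 0 ≤ fderiv ℝ (fderiv ℝ f) a v v := by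
  set B := fderiv ℝ (fderiv ℝ f) a
  refine le_of_forall_pos_le_add fun ε hε => ?_
  -- Scaled so that the Taylor error at `a + t • v` is at most `t² ε / 2`; adding 1 allows `v = 0`.
  have hε' : 0 < ε / (2 * (‖v‖ ^ 2 + 1)) := by positivity
  have h1 := (eventually_abs_sub_hessian_le hf ha.fderiv_eq_zero hε').and ha
  have hc : Tendsto (fun t : ℝ => a + t • v) (𝓝[>] 0) (𝓝 a) := by
    have : Continuous fun t : ℝ => a + t • v := by fun_prop
    simpa using (this.tendsto 0).mono_left nhdsWithin_le_nhds
  obtain ⟨t, ⟨ht1, ht2⟩, ht0⟩ := ((hc.eventually h1).and self_mem_nhdsWithin).exists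
  have ht0 : 0 < t := ht0
  simp only [add_sub_cancel_left, map_smul, smul_apply, smul_eq_mul,
    norm_smul, Real.norm_eq_abs, mul_pow, sq_abs] at ht1
  have h3 := (abs_le.1 ht1).1
  have h3' : f (a + t • v) - f a - 1 / 2 * (t * (t * B v v)) ≤
      ε / (2 * (‖v‖ ^ 2 + 1)) * (t ^ 2 * ‖v‖ ^ 2) := (abs_le.1 ht1).2
  have h4 : ε / (2 * (‖v‖ ^ 2 + 1)) * (t ^ 2 * ‖v‖ ^ 2) ≤ t ^ 2 * (ε / 2) := by
    have : ε / (2 * (‖v‖ ^ 2 + 1)) * (t ^ 2 * ‖v‖ ^ 2) =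
      t ^ 2 * (ε / 2) * (‖v‖ ^ 2 / (‖v‖ ^ 2 + 1)) := by field_simp
    rw [this]
    refine mul_le_of_le_one_right (by positivity) ?_
    rw [div_le_one (by positivity)]; linarith
  have h5 : 0 ≤ t ^ 2 * (B v v + ε) := by nlinarith
  exact nonneg_of_mul_nonneg_right h5 (by positivity)

/-- A nondegenerate positive semidefinite bilinear form in finite dimension is coercive. -/
theorem exists_coercive_of_nondegenerate [FiniteDimensional ℝ E] (B : E →L[ℝ] E →L[ℝ] ℝ)
    (hsymm : ∀ v w, B v w = B w v) (hpos : ∀ v, 0 ≤ B v v)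
    (hnd : ∀ v, (∀ w, B v w = 0) → v = 0) :
    ∃ c > 0, ∀ v, c * ‖v‖ ^ 2 ≤ B v v := by
  have hdef : ∀ v, B v v = 0 → v = 0 := by
    intro v hv
    refine hnd v fun w => ?_
    by_contra hne
    -- The form at `t • v + w` is affine in `t` because `B v v = 0`. A nonzero slope would make it
    -- negative; the `t` used below gives `-1`.
    have key : ∀ t : ℝ, 0 ≤ 2 * t * B v w + B w w := fun t => by
      have := hpos (t • v + w)
      simp only [map_add, map_smul, add_apply,
        smul_apply, smul_eq_mul, hv, hsymm w v] at this
      linarith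
    have := key (-(B w w + 1) / (2 * B v w))
    have h2 : 2 * (-(B w w + 1) / (2 * B v w)) * B v w = -(B w w + 1) := by field_simp
    linarith
  rcases subsingleton_or_nontrivial E with hE | hE
  · exact ⟨1, one_pos, fun v => by simp [Subsingleton.elim v 0]⟩
  have hcont : Continuous fun v => B v v := by fun_prop
  obtain ⟨v₀, hv₀, hmin⟩ := (isCompact_sphere (0 : E) 1).exists_isMinOn
    (NormedSpace.sphere_nonempty.2 zero_le_one) hcont.continuousOn
  have hv₀' : v₀ ≠ 0 := by rintro rfl; simp at hv₀
  refine ⟨B v₀ v₀, lt_of_le_of_ne (hpos _) fun h => hv₀' (hdef _ h.symm), fun v => ?_⟩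
  rcases eq_or_ne v 0 with rfl | hv
  · simp
  have hn : 0 < ‖v‖ := norm_pos_iff.2 hv
  have := hmin (a := ‖v‖⁻¹ • v) (by simp [norm_smul, hn.ne'])
  simp only [map_smul, smul_apply, smul_eq_mul, Set.mem_ofPred_eq] at this
  calc B v₀ v₀ * ‖v‖ ^ 2 ≤ (‖v‖⁻¹ * (‖v‖⁻¹ * B v v)) * ‖v‖ ^ 2 := by gcongr
    _ = B v v := by field_simp

/-- Quadratic growth of a `C²` function at a nondegenerate local minimum. -/
theorem IsLocalMin.exists_quadratic_growth [FiniteDimensional ℝ E] {f : E → ℝ}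
    (hf : ContDiff ℝ 2 f) {a : E} (ha : IsLocalMin f a)
    (hnd : ∀ v, (∀ w, fderiv ℝ (fderiv ℝ f) a v w = 0) → v = 0) :
    ∃ c > 0, ∀ᶠ x in 𝓝 a, f a + c * ‖x - a‖ ^ 2 ≤ f x := by
  have hsymm : IsSymmSndFDerivAt ℝ f a := hf.contDiffAt.isSymmSndFDerivAt (by simp)
  obtain ⟨c, hc, hB⟩ := exists_coercive_of_nondegenerate _ (fun v w => hsymm v w)
    (hessian_nonneg_of_isLocalMin hf ha) hnd
  -- Half the Hessian contributes `c / 2`, of which the Taylor error takes `c / 4`.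
  refine ⟨c / 4, by positivity, ?_⟩
  filter_upwards [eventually_abs_sub_hessian_le hf ha.fderiv_eq_zero
    (show 0 < c / 4 by positivity)] with x hx
  have := (abs_le.1 hx).1
  have := hB (x - a)
  linarith

end Coercivity

/-! ### Volume of sublevel sets -/

section Sublevel

variable {d : ℕ}

/-- Sublevel sets of a nonnegative function which is quadratically coercive at its zeros have
volume `O(t ^ (d / 2))` in a compact set. -/
theorem exists_volume_sublevel_le {f : (Fin d → ℝ) → ℝ} (hf : Continuous f)
    (hpos : ∀ x, 0 ≤ f x)
    (hq : ∀ a, f a = 0 → ∃ c > 0, ∀ᶠ x in 𝓝 a, c * ‖x - a‖ ^ 2 ≤ f x)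
    {K : Set (Fin d → ℝ)} (hK : IsCompact K) :
    ∃ C : ℝ, 0 ≤ C ∧ ∀ t : ℝ, 0 < t →
      volume (K ∩ {x | f x ≤ t}) ≤ ENNReal.ofReal (C * t ^ ((d : ℝ) / 2)) := by
  -- The bound is stable under subsets and finite unions, so by compactness it need only hold near
  -- each point.
  refine hK.induction_on (p := fun K => ∃ C : ℝ, 0 ≤ C ∧ ∀ t : ℝ, 0 < t →
    volume (K ∩ {x | f x ≤ t}) ≤ ENNReal.ofReal (C * t ^ ((d : ℝ) / 2))) ?_ ?_ ?_ ?_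
  · exact ⟨0, le_rfl, fun t _ => by simp⟩
  · intro s s' hs hs'
    obtain ⟨C, hC, h⟩ := hs'
    exact ⟨C, hC, fun t ht => (measure_mono (Set.inter_subset_inter_left _ hs)).trans (h t ht)⟩
  · intro s s' hs hs'
    obtain ⟨C, hC, h⟩ := hs
    obtain ⟨C', hC', h'⟩ := hs'
    refine ⟨C + C', add_nonneg hC hC', fun t ht => ?_⟩
    rw [Set.union_inter_distrib_right, add_mul,
      ENNReal.ofReal_add (by positivity) (by positivity)]
    exact (measure_union_le _ _).trans (add_le_add (h t ht) (h' t ht))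
  · intro a _
    rcases (hpos a).eq_or_lt with h0 | h0
    · obtain ⟨c, hc, hev⟩ := hq a h0.symm
      refine ⟨_, mem_nhdsWithin_of_mem_nhds hev, (2 / √c) ^ d, by positivity, fun t ht => ?_⟩
      have hsub : {x | c * ‖x - a‖ ^ 2 ≤ f x} ∩ {x | f x ≤ t} ⊆
          Metric.closedBall a (√(t / c)) := by
        rintro x ⟨hx1, hx2⟩
        rw [Metric.mem_closedBall, dist_eq_norm]
        refine Real.le_sqrt_of_sq_le ?_
        rw [le_div_iff₀ hc, mul_comm]
        exact le_trans hx1 hx2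
      refine (measure_mono hsub).trans ?_
      rw [Real.volume_pi_closedBall _ (Real.sqrt_nonneg _), Fintype.card_fin]
      refine ENNReal.ofReal_le_ofReal (le_of_eq ?_)
      rw [Real.sqrt_div ht.le, show (d : ℝ) / 2 = (1 / 2) * d by ring,
        Real.rpow_mul ht.le, ← Real.sqrt_eq_rpow, Real.rpow_natCast, ← mul_pow]
      congr 1
      ring
    -- Away from the zeros small sublevel sets are locally empty, and for `t > f a / 2` the volume
    -- of the unit ball suffices.
    · refine ⟨{x | f a / 2 < f x} ∩ Metric.ball a 1, mem_nhdsWithin_of_mem_nhds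
        (inter_mem (hf.continuousAt.eventually_const_lt (half_lt_self h0))
          (Metric.ball_mem_nhds a one_pos)), 2 ^ d / (f a / 2) ^ ((d : ℝ) / 2),
          by positivity, fun t ht => ?_⟩
      rcases le_or_gt t (f a / 2) with h | h
      · have : ({x | f a / 2 < f x} ∩ Metric.ball a 1) ∩ {x | f x ≤ t} = ∅ := by
          ext x
          simp only [Set.mem_inter_iff, Set.mem_ofPred_eq, Set.mem_empty_iff_false, iff_false,
            not_and, not_le]
          intro h1
          exact h.trans_lt h1.1
        simp [this]
      · refine (measure_mono (Set.inter_subset_left.trans Set.inter_subset_right)).trans ?_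
        rw [Real.volume_pi_ball _ one_pos, Fintype.card_fin]
        refine ENNReal.ofReal_le_ofReal ?_
        rw [div_mul_eq_mul_div, ← mul_div_assoc', ← Real.div_rpow ht.le (by positivity), mul_one]
        refine le_mul_of_one_le_right (by positivity) ?_
        refine Real.one_le_rpow ?_ (by positivity)
        rw [one_le_div (by positivity)]
        exact h.le

theorem measurePreserving_coe_torus (d : ℕ) :
    MeasurePreserving (fun (p : Fin d → ℝ) i => (p i : AddCircle (2 * Real.pi)))
      (volume.restrict (Set.univ.pi fun _ => Set.Ioc 0 (0 + 2 * Real.pi)))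
      (volume : Measure (DualTorus d)) := by
  rw [volume_pi, volume_pi, Measure.restrict_pi_pi]
  exact measurePreserving_pi _ _ fun _ => AddCircle.measurePreserving_mk (2 * Real.pi) 0

/-- Lebesgue measure is `(2π)^d ≥ 1` times normalized Haar measure; only upper bounds on volumes are
needed. -/
theorem dualHaar_le_volume (d : ℕ) : dualHaar d ≤ volume := by
  have h1 : (1 : ℝ≥0∞) ≤ ENNReal.ofReal (2 * Real.pi) := by
    rw [ENNReal.one_le_ofReal]
    linarith [Real.pi_gt_three]
  have : (volume : Measure (DualTorus d)) = (ENNReal.ofReal (2 * Real.pi)) ^ d • dualHaar d := by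
    rw [volume_pi, dualHaar]
    refine Measure.pi_eq fun s hs => ?_
    rw [Measure.smul_apply, Measure.pi_pi, smul_eq_mul]
    simp only [AddCircle.volume_eq_smul_haarAddCircle, Measure.smul_apply, smul_eq_mul,
      Finset.prod_mul_distrib]
    simp
  rw [this]
  refine Measure.le_iff.2 fun s _ => ?_
  rw [Measure.smul_apply, smul_eq_mul]
  exact le_mul_of_one_le_left' (one_le_pow₀ h1)

theorem LatticeSchrodinger.IsAdmissible.nonneg {e : C(DualTorus d, ℝ)} (he : IsAdmissible e)
    (p : DualTorus d) : 0 ≤ e p := he.isLeast_zero.2 ⟨p, rfl⟩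

/-- Sublevel sets of an admissible dispersion relation have measure `O(t ^ (d / 2))`. -/
theorem LatticeSchrodinger.IsAdmissible.exists_measure_sublevel_le
    {e : C(DualTorus d, ℝ)} (he : IsAdmissible e) :
    ∃ C : ℝ, 0 ≤ C ∧ ∀ t : ℝ, 0 < t →
      dualHaar d {p | e p ≤ t} ≤ ENNReal.ofReal (C * t ^ ((d : ℝ) / 2)) := by
  -- Zeros of the lift are global minima, hence critical points, where the Morse condition applies.
  have hmin : ∀ a, periodicLift e a = 0 → IsLocalMin (periodicLift e) a := fun a ha =>
    Eventually.of_forall fun x => ha.trans_le (he.nonneg _)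
  obtain ⟨C, hC, h⟩ := exists_volume_sublevel_le (f := periodicLift e) he.contDiff.continuous
    (fun x => he.nonneg _) (fun a ha => by
      simpa [ha] using (hmin a ha).exists_quadratic_growth he.contDiff
        (he.morse a (hmin a ha).fderiv_eq_zero))
    (K := Set.univ.pi fun _ => Set.Icc 0 (0 + 2 * Real.pi))
    (isCompact_univ_pi fun _ => isCompact_Icc)
  refine ⟨C, hC, fun t ht => ?_⟩
  have hms : MeasurableSet {p | e p ≤ t} := measurableSet_le e.continuous.measurable
    measurable_const
  refine (dualHaar_le_volume d _).trans ?_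
  rw [← (measurePreserving_coe_torus d).measure_preimage hms.nullMeasurableSet,
    Measure.restrict_apply ((measurePreserving_coe_torus d).measurable hms), Set.inter_comm]
  refine le_trans (measure_mono ?_) (h t ht)
  exact Set.inter_subset_inter_left _ (Set.pi_mono fun _ _ => Set.Ioc_subset_Icc_self)

end Sublevel

/-! ### Dyadic sums -/

section Dyadic

/-- If the sublevel sets of `f` have measure `O(t ^ s)` with `s > 1`, then `1 / f` is integrable
on them, with integral `O(t ^ (s - 1))`. -/
theorem exists_lintegral_inv_sublevel_le {X : Type*} [MeasurableSpace X] {μ : Measure X}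
    {f : X → ℝ} (hf : Measurable f) {s C : ℝ} (hs : 1 < s) (hC : 0 ≤ C)
    (h : ∀ t : ℝ, 0 < t → μ {p | f p ≤ t} ≤ ENNReal.ofReal (C * t ^ s)) :
    ∃ C' : ℝ, 0 ≤ C' ∧ ∀ t : ℝ, 0 < t →
      ∫⁻ p, Set.indicator {p | f p ≤ t} (fun p => ENNReal.ofReal (f p)⁻¹) p ∂μ ≤
        ENNReal.ofReal (C' * t ^ (s - 1)) := by
  set r : ℝ := (1 / 2) ^ (s - 1) with hr
  have hr0 : 0 ≤ r := by positivity
  have hr1 : r < 1 := Real.rpow_lt_one (by norm_num) (by norm_num) (by linarith)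
  have hms : ∀ t : ℝ, MeasurableSet {p | f p ≤ t} := fun t => measurableSet_le hf measurable_const
  refine ⟨2 * C * (1 - r)⁻¹, by have := sub_pos.2 hr1; positivity, fun t ht => ?_⟩
  have hpt : ∀ p, Set.indicator {p | f p ≤ t} (fun p => ENNReal.ofReal (f p)⁻¹) p ≤
      ∑' n : ℕ, Set.indicator {p | f p ≤ t * (1 / 2) ^ n}
        (fun _ => ENNReal.ofReal (2 ^ (n + 1) / t)) p := by
    intro p
    by_cases hp : f p ≤ t
    · rw [Set.indicator_of_mem (show p ∈ {p | f p ≤ t} from hp)]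
      rcases le_or_gt (f p) 0 with h0 | h0
      -- Where `f ≤ 0` the integrand is zero by convention, so the zero set of `f` has to be shown
      -- null separately.
      · rw [ENNReal.ofReal_of_nonpos (inv_nonpos.2 h0)]
        exact zero_le
      -- On the shell `2^(-n-1) < f / t ≤ 2^(-n)` one has `1 / f ≤ 2^(n+1) / t`. The shells sum to a
      -- geometric series of ratio `2^(1-s)`, convergent because `s > 1`.
      obtain ⟨n, hn1, hn2⟩ := exists_nat_pow_near_of_lt_one (x := f p / t) (y := (1 / 2 : ℝ))
        (by positivity) ((div_le_one ht).2 hp) (by norm_num) (by norm_num)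
      rw [lt_div_iff₀ ht] at hn1
      rw [div_le_iff₀ ht] at hn2
      refine le_trans ?_ (ENNReal.le_tsum n)
      rw [Set.indicator_of_mem (show p ∈ {p | f p ≤ t * (1 / 2) ^ n} by
        simpa only [Set.mem_ofPred_eq, mul_comm] using hn2)]
      refine ENNReal.ofReal_le_ofReal ?_
      rw [inv_le_iff_one_le_mul₀ h0, div_mul_eq_mul_div, one_le_div ht]
      calc t = 2 ^ (n + 1) * ((1 / 2) ^ (n + 1) * t) := by
            rw [← mul_assoc, ← mul_pow]; norm_num
        _ ≤ _ := by gcongr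
    · rw [Set.indicator_of_notMem (show p ∉ {p | f p ≤ t} from hp)]
      exact zero_le
  calc _ ≤ ∫⁻ p, ∑' n : ℕ, Set.indicator {p | f p ≤ t * (1 / 2) ^ n}
        (fun _ => ENNReal.ofReal (2 ^ (n + 1) / t)) p ∂μ := lintegral_mono hpt
    _ = ∑' n : ℕ, ENNReal.ofReal (2 ^ (n + 1) / t) * μ {p | f p ≤ t * (1 / 2) ^ n} := by
        rw [lintegral_tsum fun n => (measurable_const.indicator (hms _)).aemeasurable]
        simp_rw [lintegral_indicator_const (hms _)]
    _ ≤ ∑' n : ℕ, ENNReal.ofReal ((2 * C * t ^ (s - 1)) * r ^ n) := by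
        refine ENNReal.tsum_le_tsum fun n => ?_
        refine (mul_le_mul_right (h _ (by positivity)) _).trans (le_of_eq ?_)
        rw [← ENNReal.ofReal_mul (by positivity)]
        congr 1
        have e1 : t ^ s = t ^ (s - 1) * t := by
          conv_lhs => rw [show s = s - 1 + 1 by ring]
          rw [Real.rpow_add_one ht.ne']
        have e2 : ((1 / 2 : ℝ) ^ n) ^ s = r ^ n * (1 / 2) ^ n := by
          have : ((1 / 2 : ℝ) ^ n) ^ s = ((1 / 2 : ℝ) ^ s) ^ n := by
            rw [← Real.rpow_natCast, ← Real.rpow_mul (by norm_num), mul_comm,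
              Real.rpow_mul (by norm_num), Real.rpow_natCast]
          rw [this, hr, ← mul_pow]
          congr 1
          conv_lhs => rw [show s = s - 1 + 1 by ring]
          rw [Real.rpow_add_one (by norm_num)]
        rw [Real.mul_rpow ht.le (by positivity), e1, e2]
        have e3 : (2 : ℝ) ^ (n + 1) * (1 / 2) ^ n = 2 := by
          rw [pow_succ, mul_right_comm, ← mul_pow]; norm_num
        calc 2 ^ (n + 1) / t * (C * (t ^ (s - 1) * t * (r ^ n * (1 / 2) ^ n)))
            = (2 ^ (n + 1) * (1 / 2) ^ n) * C * t ^ (s - 1) * r ^ n := by field_simp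
          _ = _ := by rw [e3]
    _ = ENNReal.ofReal (2 * C * (1 - r)⁻¹ * t ^ (s - 1)) := by
        rw [← ENNReal.ofReal_tsum_of_nonneg (fun n => by positivity)
          ((summable_geometric_of_lt_one hr0 hr1).mul_left _), tsum_mul_left,
          tsum_geometric_of_lt_one hr0 hr1]
        congr 1
        ring

/-- The powers of two below `t` add up to at most `2 * t`. -/
theorem tsum_zpow_two_indicator_le {t : ℝ} (ht : 0 < t) :
    ∑' k : ℤ, (Set.indicator {k : ℤ | (2 : ℝ) ^ k < t}
      (fun k => ENNReal.ofReal ((2 : ℝ) ^ k)) k) ≤ ENNReal.ofReal (2 * t) := by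
  obtain ⟨m, hm1, hm2⟩ := exists_mem_Ioc_zpow ht (one_lt_two (α := ℝ))
  have hinj : Function.Injective fun n : ℕ => m - (n : ℤ) := fun a b h => by
    simpa using h
  rw [← hinj.tsum_eq]
  · calc _ ≤ ∑' n : ℕ, ENNReal.ofReal ((2 : ℝ) ^ m * (1 / 2) ^ n) := by
          refine ENNReal.tsum_le_tsum fun n => (Set.indicator_le_self _ _ _).trans ?_
          rw [zpow_sub₀ two_ne_zero, zpow_natCast, one_div, inv_pow, div_eq_mul_inv]
      _ = ENNReal.ofReal (2 ^ m * 2) := by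
          rw [← ENNReal.ofReal_tsum_of_nonneg (fun n => by positivity)
            (summable_geometric_two.mul_left _), tsum_mul_left, tsum_geometric_two]
      _ ≤ _ := ENNReal.ofReal_le_ofReal (by linarith)
  · intro k hk
    have hk' : (2 : ℝ) ^ k < t := by
      by_contra hne
      exact hk (Set.indicator_of_notMem (by simpa using hne) _)
    have : k < m + 1 := (zpow_lt_zpow_iff_right₀ (one_lt_two (α := ℝ))).1 (hk'.trans_le hm2)
    exact ⟨(m - k).toNat, by simp only; omega⟩

end Dyadic

/-! ### The quadratic form on the negative spectral subspace -/

section NegativePart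

variable {E : Type*} [NormedAddCommGroup E] [InnerProductSpace ℂ E] [CompleteSpace E]

/-- The quadratic form of a bounded self-adjoint operator is nonpositive on its negative spectral
subspace. -/
theorem re_inner_le_zero_of_mem_negSpectralSubspace {A : E →L[ℂ] E} (hA : IsSelfAdjoint A)
    {u : E} (hu : u ∈ negSpectralSubspace A) : (inner ℂ u (A u)).re ≤ 0 := by
  have hclosed : IsClosed {u : E | (inner ℂ u (A u)).re ≤ 0} :=
    isClosed_le (Complex.continuous_re.comp (continuous_id.inner A.continuous)) continuous_const
  refine closure_minimal ?_ hclosed hu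
  rintro _ ⟨w, rfl⟩
  -- On the range of `A⁻` the operator acts as `-A⁻`, so its form is nonpositive there and, by
  -- continuity, on the closure.
  have hmul : A * A⁻ = -(A⁻ * A⁻) := by
    have : A * A⁻ = (A⁺ - A⁻) * A⁻ := by rw [CFC.posPart_sub_negPart A hA]
    rw [this, sub_mul, CFC.posPart_mul_negPart, zero_sub]
  have h1 : A (A⁻ w) = -(A⁻ (A⁻ w)) := by
    simpa using congrArg (fun B : E →L[ℂ] E => B w) hmul
  have hpos : (A⁻).IsPositive :=
    (ContinuousLinearMap.nonneg_iff_isPositive _).1 (CFC.negPart_nonneg A)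
  have h2 := hpos.re_inner_nonneg_right (A⁻ w)
  simp only [Set.mem_ofPred_eq]
  change (inner ℂ (A⁻ w) (A (A⁻ w))).re ≤ 0
  rw [h1, inner_neg_right, Complex.neg_re]
  exact neg_nonpos.2 h2

end NegativePart

/-! ### Multipliers and plane waves -/

section FourierSide

variable {d : ℕ}

theorem coeFn_torusMul (g : C(DualTorus d, ℝ)) (f : Lp ℂ 2 (dualHaar d)) :
    torusMul g f =ᵐ[dualHaar d] fun p => (g p : ℂ) * f p := by
  have h := fourierStar_hopping g ((fourierStar d).symm f)
  have h1 : fourierStar d (hopping g ((fourierStar d).symm f)) = torusMul g f := by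
    simp [hopping]
  simpa only [h1, LinearIsometryEquiv.apply_symm_apply] using h

theorem enorm_sq_eq_lintegral {X : Type*} [MeasurableSpace X] {μ : Measure X}
    (f : Lp ℂ 2 μ) : ‖f‖ₑ ^ 2 = ∫⁻ p, ‖f p‖ₑ ^ 2 ∂μ := by
  rw [Lp.enorm_def]
  have := eLpNorm_nnreal_pow_eq_lintegral (f := f) (μ := μ) (p := 2) two_ne_zero
  simpa using this

theorem coeFn_eq_inner_planeWave (u : LTwo d) (x : Lattice d) :
    u x = inner ℂ (planeWave x) (fourierStar d u) := by
  have h := (planeWaveBasis d).repr_apply_apply (fourierStar d u) x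
  rw [fourierStar, LinearIsometryEquiv.apply_symm_apply] at h
  rw [h, fourierStar]
  simp [planeWaveBasis]

/-- Parseval's identity for the plane waves. -/
theorem tsum_enorm_inner_planeWave_sq (f : Lp ℂ 2 (dualHaar d)) :
    ∑' x, ‖inner ℂ (planeWave x) f‖ₑ ^ 2 = ‖f‖ₑ ^ 2 := by
  have h1 := (planeWaveBasis d).tsum_inner_mul_inner f f
  have h2 := ((planeWaveBasis d).summable_inner_mul_inner f f)
  have h3 : ∀ x, inner ℂ f (planeWaveBasis d x) * inner ℂ (planeWaveBasis d x) f =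
      ((‖inner ℂ (planeWave x) f‖ ^ 2 : ℝ) : ℂ) := by
    intro x
    rw [← inner_conj_symm, ← Complex.normSq_eq_conj_mul_self, Complex.normSq_eq_norm_sq]
    simp [planeWaveBasis]
  simp_rw [h3] at h1 h2
  rw [← Complex.ofReal_tsum, inner_self_eq_norm_sq_to_K] at h1
  have h2' : Summable fun x => ‖inner ℂ (planeWave x) f‖ ^ 2 := Complex.summable_ofReal.1 h2
  have h4 : ∑' x, ‖inner ℂ (planeWave x) f‖ ^ 2 = ‖f‖ ^ 2 := by
    refine Complex.ofReal_injective (h1.trans ?_)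
    simp
  simp_rw [← ofReal_norm, ← ENNReal.ofReal_pow (norm_nonneg _)]
  rw [← ENNReal.ofReal_tsum_of_nonneg (fun _ => by positivity) h2', h4]

theorem coeFn_planeWave (x : Lattice d) :
    planeWave x =ᵐ[dualHaar d] fun p => character (-x) p :=
  ContinuousMap.coeFn_toLp (p := 2) (𝕜 := ℂ) (dualHaar d) (character (-x))

theorem norm_character (x : Lattice d) (p : DualTorus d) : ‖character x p‖ = 1 := by
  simp only [character, ContinuousMap.coe_mk, norm_prod]
  exact Finset.prod_eq_one fun i _ => Circle.norm_coe _

end FourierSide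

/-! ### The kinetic energy form -/

section EnergyForm

variable {d : ℕ}

/-- The pointwise square root of a symbol. -/
noncomputable def sqrtSymbol (e : C(DualTorus d, ℝ)) : C(DualTorus d, ℝ) where
  toFun p := √(e p)

/-- The map `u ↦ e ^ (1 / 2) 𝓕* u`, whose squared norm is the quadratic form of `h(e)`. -/
noncomputable def energyMap (e : C(DualTorus d, ℝ)) : LTwo d →L[ℂ] Lp ℂ 2 (dualHaar d) :=
  torusMul (sqrtSymbol e) ∘L (fourierStar d).toContinuousLinearEquiv.toContinuousLinearMap

theorem coeFn_energyMap (e : C(DualTorus d, ℝ)) (u : LTwo d) :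
    energyMap e u =ᵐ[dualHaar d] fun p => (√(e p) : ℂ) * fourierStar d u p :=
  coeFn_torusMul (sqrtSymbol e) (fourierStar d u)

theorem enorm_energyMap_sq {e : C(DualTorus d, ℝ)} (he : ∀ p, 0 ≤ e p) (u : LTwo d) :
    ‖energyMap e u‖ₑ ^ 2 = ∫⁻ p, ENNReal.ofReal (e p) * ‖fourierStar d u p‖ₑ ^ 2 ∂dualHaar d := by
  rw [enorm_sq_eq_lintegral]
  refine lintegral_congr_ae ?_
  filter_upwards [coeFn_energyMap e u] with p hp
  rw [hp, enorm_mul, mul_pow]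
  congr 1
  rw [← ofReal_norm, ← ENNReal.ofReal_pow (norm_nonneg _), Complex.norm_real, Real.norm_eq_abs,
    sq_abs, Real.sq_sqrt (he p)]

/-- This makes the energy form an inner product, so passing to energy space loses no dimensions. -/
theorem energyMap_injective {e : C(DualTorus d, ℝ)} (he : ∀ᵐ p ∂dualHaar d, 0 < e p) :
    Function.Injective (energyMap e) := by
  refine (injective_iff_map_eq_zero _).2 fun u hu => ?_
  have h1 := coeFn_energyMap e u
  rw [hu] at h1
  rw [← (fourierStar d).map_eq_zero_iff, Lp.eq_zero_iff_ae_eq_zero]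
  filter_upwards [h1, he, Lp.coeFn_zero ℂ 2 (dualHaar d)] with p hp hep h0
  rw [h0] at hp
  have : (√(e p) : ℂ) ≠ 0 := by exact_mod_cast (Real.sqrt_pos.2 hep).ne'
  simpa [this] using hp.symm

theorem inner_hopping_self {e : C(DualTorus d, ℝ)} (he : ∀ p, 0 ≤ e p) (u : LTwo d) :
    inner ℂ u (hopping e u) = inner ℂ (energyMap e u) (energyMap e u) := by
  rw [← (fourierStar d).inner_map_map, L2.inner_def, L2.inner_def]
  refine integral_congr_ae ?_
  filter_upwards [fourierStar_hopping e u, coeFn_energyMap e u] with p h1 h2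
  have h3 : (e p : ℂ) = (√(e p) : ℂ) * (√(e p) : ℂ) := by
    exact_mod_cast (Real.mul_self_sqrt (he p)).symm
  rw [h1, h2, h3]
  simp only [RCLike.inner_apply, map_mul, Complex.conj_ofReal]
  ring

/-- Nonpositivity of the form of `h(e) - W`, rearranged. Boundedness of `W` ensures that
`potentialMul W` is genuine multiplication and not its default value 0. -/
theorem enorm_energyMap_sq_le {e : C(DualTorus d, ℝ)} (he : ∀ p, 0 ≤ e p) {W : Lattice d → ℝ}
    (hW : ∀ x, 0 ≤ W x) (hWb : Memℓp W ∞) {u : LTwo d}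
    (hu : u ∈ negSpectralSubspace (schrodinger e W)) :
    ‖energyMap e u‖ₑ ^ 2 ≤ ∑' x, ENNReal.ofReal (W x) * ‖u x‖ₑ ^ 2 := by
  have h1 := re_inner_le_zero_of_mem_negSpectralSubspace (isSelfAdjoint_schrodinger e W) hu
  have hterm : ∀ x, inner ℂ (u x) (potentialMul W u x) = ((W x * ‖u x‖ ^ 2 : ℝ) : ℂ) := by
    intro x
    rw [potentialMul_apply hWb, RCLike.inner_apply, mul_assoc, Complex.mul_conj,
      Complex.normSq_eq_norm_sq]
    push_cast; ring
  have h2 : HasSum (fun x => W x * ‖u x‖ ^ 2) (inner ℂ u (potentialMul W u)).re := by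
    have : HasSum (fun x => inner ℂ (u x) (potentialMul W u x)) (inner ℂ u (potentialMul W u)) :=
      lp.hasSum_inner u (potentialMul W u)
    simp_rw [hterm] at this
    simpa only [Complex.ofReal_re] using Complex.hasSum_re this
  rw [schrodinger, sub_apply, inner_sub_right, Complex.sub_re, inner_hopping_self he,
    inner_self_eq_norm_sq_to_K] at h1
  have h3 : ‖energyMap e u‖ ^ 2 ≤ ∑' x, W x * ‖u x‖ ^ 2 := by
    rw [h2.tsum_eq]
    have : (((‖energyMap e u‖ : ℝ) : ℂ) ^ 2).re = ‖energyMap e u‖ ^ 2 := by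
      rw [← Complex.ofReal_pow, Complex.ofReal_re]
    change (((‖energyMap e u‖ : ℝ) : ℂ) ^ 2).re - _ ≤ 0 at h1
    linarith
  have h4 : ∀ x, ENNReal.ofReal (W x) * ‖u x‖ₑ ^ 2 = ENNReal.ofReal (W x * ‖u x‖ ^ 2) := by
    intro x
    rw [ENNReal.ofReal_mul (hW x), ← ofReal_norm, ENNReal.ofReal_pow (norm_nonneg _)]
  simp_rw [h4]
  rw [← ENNReal.ofReal_tsum_of_nonneg (fun x => mul_nonneg (hW x) (by positivity)) h2.summable,
    ← ofReal_norm, ← ENNReal.ofReal_pow (norm_nonneg _)]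
  exact ENNReal.ofReal_le_ofReal h3

end EnergyForm

/-! ### Splitting into low and high energies -/

section Cutoff

variable {d : ℕ}

/-- A continuous cutoff to energies at most `2 * t`, equal to one for energies at most `t`. -/
noncomputable def lowCutoff (e : C(DualTorus d, ℝ)) (t : ℝ) : C(DualTorus d, ℝ) where
  toFun p := max 0 (min 1 (2 - e p / t))

/-- The complementary cutoff to energies above `t`. -/
noncomputable def highCutoff (e : C(DualTorus d, ℝ)) (t : ℝ) : C(DualTorus d, ℝ) :=
  1 - lowCutoff e t

variable (e : C(DualTorus d, ℝ)) {t : ℝ}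

theorem lowCutoff_nonneg (p : DualTorus d) : 0 ≤ lowCutoff e t p := le_max_left _ _

theorem lowCutoff_le_one (p : DualTorus d) : lowCutoff e t p ≤ 1 :=
  max_le zero_le_one (min_le_left _ _)

theorem lowCutoff_eq_zero (ht : 0 < t) {p : DualTorus d} (hp : 2 * t < e p) :
    lowCutoff e t p = 0 := by
  have : 2 < e p / t := by rwa [lt_div_iff₀ ht]
  exact max_eq_left ((min_le_right _ _).trans (by linarith))

theorem highCutoff_eq_zero (ht : 0 < t) {p : DualTorus d} (hp : e p ≤ t) :
    highCutoff e t p = 0 := by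
  have : e p / t ≤ 1 := by rwa [div_le_one ht]
  have h1 : lowCutoff e t p = 1 := by
    change max 0 (min 1 (2 - e p / t)) = 1
    rw [min_eq_left (by linarith), max_eq_right zero_le_one]
  simp [highCutoff, h1]

theorem abs_highCutoff_le_one (p : DualTorus d) : |highCutoff e t p| ≤ 1 := by
  have h1 := lowCutoff_nonneg e (t := t) p
  have h2 := lowCutoff_le_one e (t := t) p
  simp only [highCutoff, ContinuousMap.sub_apply, ContinuousMap.one_apply]
  rw [abs_le]
  constructor <;> linarith

theorem torusMul_low_add_high (f : Lp ℂ 2 (dualHaar d)) :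
    torusMul (lowCutoff e t) f + torusMul (highCutoff e t) f = f := by
  refine Lp.ext ?_
  filter_upwards [Lp.coeFn_add (torusMul (lowCutoff e t) f) (torusMul (highCutoff e t) f),
    coeFn_torusMul (lowCutoff e t) f, coeFn_torusMul (highCutoff e t) f] with p h1 h2 h3
  rw [h1, Pi.add_apply, h2, h3]
  simp [highCutoff]
  ring

/-- Bessel's inequality for the low-energy part of a family which is orthonormal in energy. -/
theorem sum_enorm_inner_low_sq_le (hpos : ∀ᵐ p ∂dualHaar d, 0 < e p) (ht : 0 < t)
    {ι : Type*} [Fintype ι] {u : ι → LTwo d} (hu : Orthonormal ℂ fun j => energyMap e (u j))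
    (x : Lattice d) :
    ∑ j, ‖inner ℂ (planeWave x) (torusMul (lowCutoff e t) (fourierStar d (u j)))‖ₑ ^ 2 ≤
      ∫⁻ p, Set.indicator {p | e p ≤ 2 * t} (fun p => ENNReal.ofReal (e p)⁻¹) p ∂dualHaar d := by
  set I := ∫⁻ p, Set.indicator {p | e p ≤ 2 * t} (fun p => ENNReal.ofReal (e p)⁻¹) p ∂dualHaar d
  rcases eq_or_ne I ⊤ with hI | hI
  · rw [hI]; exact le_top
  -- Moving `e^(-1/2)` onto the plane wave turns the low-energy value at `x` into an inner product
  -- with the orthonormal family `energyMap e (u j)`; Bessel then bounds the sum by `‖g‖²`.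
  set g : DualTorus d → ℂ := fun p =>
    ((lowCutoff e t p * (√(e p))⁻¹ : ℝ) : ℂ) * character (-x) p with hg
  have hgm : Measurable g :=
    (Complex.measurable_ofReal.comp ((lowCutoff e t).continuous.measurable.mul
      e.continuous.measurable.sqrt.inv)).mul (character (-x)).continuous.measurable
  have hgI : eLpNorm g 2 (dualHaar d) ^ 2 ≤ I := by
    have h1 := eLpNorm_nnreal_pow_eq_lintegral (f := g) (μ := dualHaar d) (p := 2) two_ne_zero
    have h2 : eLpNorm g 2 (dualHaar d) ^ 2 = ∫⁻ p, ‖g p‖ₑ ^ 2 ∂dualHaar d := by simpa using h1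
    rw [h2]
    refine lintegral_mono_ae ?_
    filter_upwards [hpos] with p hp
    have h3 : ‖g p‖ₑ ^ 2 = ENNReal.ofReal (lowCutoff e t p ^ 2 * (e p)⁻¹) := by
      rw [← ofReal_norm, ← ENNReal.ofReal_pow (norm_nonneg _), hg]
      simp only [norm_mul, norm_character, mul_one, Complex.norm_real, Real.norm_eq_abs, sq_abs,
        mul_pow, inv_pow, Real.sq_sqrt hp.le]
    rw [h3]
    by_cases hpt : e p ≤ 2 * t
    · rw [Set.indicator_of_mem (show p ∈ {p | e p ≤ 2 * t} from hpt)]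
      refine ENNReal.ofReal_le_ofReal (mul_le_of_le_one_left (inv_nonneg.2 hp.le) ?_)
      exact pow_le_one₀ (lowCutoff_nonneg e p) (lowCutoff_le_one e p)
    · simp [lowCutoff_eq_zero e ht (not_le.1 hpt)]
  have hgL : MemLp g 2 (dualHaar d) := by
    refine ⟨hgm.aestronglyMeasurable, lt_top_iff_ne_top.2 fun h => ?_⟩
    rw [h] at hgI
    exact hI (top_le_iff.1 (by simpa using hgI))
  have hinner : ∀ j, inner ℂ (planeWave x) (torusMul (lowCutoff e t) (fourierStar d (u j))) =
      inner ℂ hgL.toLp (energyMap e (u j)) := by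
    intro j
    rw [L2.inner_def, L2.inner_def]
    refine integral_congr_ae ?_
    filter_upwards [hpos, hgL.coeFn_toLp, coeFn_planeWave x, coeFn_energyMap e (u j),
      coeFn_torusMul (lowCutoff e t) (fourierStar d (u j))] with p h0 h1 h2 h3 h4
    rw [h1, h2, h3, h4, hg]
    have : (√(e p) : ℂ) ≠ 0 := by exact_mod_cast (Real.sqrt_pos.2 h0).ne'
    simp only [RCLike.inner_apply, map_mul, Complex.conj_ofReal]
    push_cast
    field_simp
  calc _ = ENNReal.ofReal (∑ j, ‖inner ℂ (energyMap e (u j)) hgL.toLp‖ ^ 2) := by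
        rw [ENNReal.ofReal_sum_of_nonneg fun _ _ => by positivity]
        refine Finset.sum_congr rfl fun j _ => ?_
        rw [hinner, norm_inner_symm, ← ofReal_norm, ENNReal.ofReal_pow (norm_nonneg _)]
    _ ≤ ENNReal.ofReal (‖hgL.toLp‖ ^ 2) :=
        ENNReal.ofReal_le_ofReal (hu.sum_inner_products_le _)
    _ = eLpNorm g 2 (dualHaar d) ^ 2 := by
        rw [ENNReal.ofReal_pow (norm_nonneg _), ofReal_norm, Lp.enorm_def]
        congr 1
        exact eLpNorm_congr_ae hgL.coeFn_toLp
    _ ≤ I := hgI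

/-- The high-energy parts at dyadic energies are controlled by the total energy. -/
theorem tsum_tsum_enorm_inner_high_sq_le (hpos : ∀ p, 0 ≤ e p) (u : LTwo d) :
    ∑' (x : Lattice d) (k : ℤ), ENNReal.ofReal ((2 : ℝ) ^ k) *
      ‖inner ℂ (planeWave x) (torusMul (highCutoff e (2 ^ k)) (fourierStar d u))‖ₑ ^ 2 ≤
      2 * ‖energyMap e u‖ₑ ^ 2 := by
  -- For fixed `k` the cutoff does not depend on `x`, so Parseval's identity sums over the sites.
  rw [ENNReal.tsum_comm]
  simp_rw [ENNReal.tsum_mul_left, tsum_enorm_inner_planeWave_sq, enorm_sq_eq_lintegral (torusMul _ _)]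
  set f := fourierStar d u with hf
  have hfm : AEMeasurable (fun p => ‖f p‖ₑ ^ 2) (dualHaar d) :=
    (Lp.aestronglyMeasurable f).enorm.pow_const 2
  have h2k : ∀ k : ℤ, (0 : ℝ) < 2 ^ k := fun k => by positivity
  have hbound : ∀ k : ℤ, ENNReal.ofReal ((2 : ℝ) ^ k) *
      ∫⁻ p, ‖torusMul (highCutoff e (2 ^ k)) f p‖ₑ ^ 2 ∂dualHaar d ≤
      ∫⁻ p, Set.indicator {p | (2 : ℝ) ^ k < e p} (fun _ => ENNReal.ofReal ((2 : ℝ) ^ k)) p *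
        ‖f p‖ₑ ^ 2 ∂dualHaar d := by
    intro k
    rw [← lintegral_const_mul' _ _ ENNReal.ofReal_ne_top]
    refine lintegral_mono_ae ?_
    filter_upwards [coeFn_torusMul (highCutoff e (2 ^ k)) f] with p hp
    rw [hp, enorm_mul, mul_pow]
    by_cases h : (2 : ℝ) ^ k < e p
    · rw [Set.indicator_of_mem (show p ∈ {p | (2 : ℝ) ^ k < e p} from h)]
      gcongr
      refine mul_le_of_le_one_left zero_le (pow_le_one₀ zero_le ?_)
      rw [← ofReal_norm, Complex.norm_real, Real.norm_eq_abs, ENNReal.ofReal_le_one]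
      exact abs_highCutoff_le_one e p
    · rw [highCutoff_eq_zero e (h2k k) (not_lt.1 h)]
      simp
  refine (ENNReal.tsum_le_tsum hbound).trans ?_
  have hm : ∀ k : ℤ, AEMeasurable (fun p => Set.indicator {p | (2 : ℝ) ^ k < e p}
      (fun _ => ENNReal.ofReal ((2 : ℝ) ^ k)) p * ‖f p‖ₑ ^ 2) (dualHaar d) := fun k =>
    (measurable_const.indicator
      (measurableSet_lt measurable_const e.continuous.measurable)).aemeasurable.mul hfm
  rw [← lintegral_tsum hm,
    enorm_energyMap_sq hpos, ← lintegral_const_mul' _ _ ENNReal.ofNat_ne_top]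
  refine lintegral_mono fun p => ?_
  rw [ENNReal.tsum_mul_right, ← mul_assoc]
  gcongr
  -- Only scales `2^k < e p` survive the high cutoff, and they add up to at most `2 * e p`.
  rcases (hpos p).eq_or_lt with h | h
  · rw [← h, ENNReal.ofReal_zero, mul_zero, nonpos_iff_eq_zero, ENNReal.tsum_eq_zero]
    intro k
    exact Set.indicator_of_notMem (by simpa [← h] using (h2k k).le) _
  · refine le_trans (le_of_eq ?_) ((tsum_zpow_two_indicator_le h).trans (le_of_eq ?_))
    · exact tsum_congr fun k => by simp [Set.indicator_apply]
    · rw [ENNReal.ofReal_mul two_pos.le]; simp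

end Cutoff

/-! ### The Cwikel–Lieb–Rozenblum bound -/

section CLR

variable {d : ℕ}

/-- Pointwise bound of the potential energy density of a family which is orthonormal in energy,
by a phase space term and the high-energy parts at dyadic energies. -/
theorem ofReal_mul_sum_enorm_sq_le (e : C(DualTorus d, ℝ)) (hpos : ∀ᵐ p ∂dualHaar d, 0 < e p)
    {s C : ℝ} (hs : 1 < s) (hC : 0 ≤ C)
    (hint : ∀ t : ℝ, 0 < t → ∫⁻ p, Set.indicator {p | e p ≤ t}
      (fun p => ENNReal.ofReal (e p)⁻¹) p ∂dualHaar d ≤ ENNReal.ofReal (C * t ^ (s - 1)))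
    {ι : Type*} [Fintype ι] {u : ι → LTwo d} (hu : Orthonormal ℂ fun j => energyMap e (u j))
    {w : ℝ} (hw : 0 ≤ w) (x : Lattice d) :
    ENNReal.ofReal w * ∑ j, ‖u j x‖ₑ ^ 2 ≤ ENNReal.ofReal (2 * C * 32 ^ (s - 1) * w ^ s) +
      4⁻¹ * ∑ j, ∑' k : ℤ, ENNReal.ofReal ((2 : ℝ) ^ k) *
        ‖inner ℂ (planeWave x) (torusMul (highCutoff e (2 ^ k)) (fourierStar d (u j)))‖ₑ ^ 2 := by
  rcases hw.eq_or_lt with rfl | hw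
  · simp
  -- The threshold `t = 2^(m+1)` satisfies `8w ≤ t < 16w`. The lower bound gives `2w ≤ t / 4` for
  -- the high part, the upper one `2t ≤ 32w` for the low part.
  obtain ⟨m, hm1, hm2⟩ := exists_mem_Ioc_zpow (show 0 < 8 * w by positivity)
    (one_lt_two (α := ℝ))
  set k : ℤ := m + 1
  set t : ℝ := 2 ^ k with ht
  have ht0 : 0 < t := by positivity
  have ht16 : t ≤ 16 * w := by
    rw [ht, zpow_add_one₀ two_ne_zero]; linarith
  set a : ι → ℂ := fun j =>
    inner ℂ (planeWave x) (torusMul (lowCutoff e t) (fourierStar d (u j))) with ha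
  set b : ι → ℂ := fun j =>
    inner ℂ (planeWave x) (torusMul (highCutoff e t) (fourierStar d (u j))) with hb
  have hab : ∀ j, u j x = a j + b j := fun j => by
    rw [coeFn_eq_inner_planeWave, ha, hb]
    simp only
    rw [← inner_add_right, torusMul_low_add_high]
  have hsq : ∀ j, ‖u j x‖ₑ ^ 2 ≤ 2 * ‖a j‖ₑ ^ 2 + 2 * ‖b j‖ₑ ^ 2 := by
    intro j
    rw [hab]
    simp_rw [← ofReal_norm, ← ENNReal.ofReal_pow (norm_nonneg _)]
    rw [← ENNReal.ofReal_ofNat, ← ENNReal.ofReal_mul (by norm_num),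
      ← ENNReal.ofReal_mul (by norm_num), ← ENNReal.ofReal_add (by positivity) (by positivity)]
    refine ENNReal.ofReal_le_ofReal ?_
    have h1 := norm_add_le (a j) (b j)
    have h2 := pow_le_pow_left₀ (norm_nonneg _) h1 2
    nlinarith [sq_nonneg (‖a j‖ - ‖b j‖)]
  have hlow : ∑ j, ‖a j‖ₑ ^ 2 ≤ ENNReal.ofReal (C * (32 * w) ^ (s - 1)) := by
    refine (sum_enorm_inner_low_sq_le e hpos ht0 hu x).trans
      ((hint (2 * t) (by positivity)).trans (ENNReal.ofReal_le_ofReal ?_))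
    have : 0 ≤ s - 1 := by linarith
    have : 2 * t ≤ 32 * w := by linarith
    gcongr
  have hhigh : ∑ j, ENNReal.ofReal t * ‖b j‖ₑ ^ 2 ≤
      ∑ j, ∑' k : ℤ, ENNReal.ofReal ((2 : ℝ) ^ k) *
        ‖inner ℂ (planeWave x) (torusMul (highCutoff e (2 ^ k)) (fourierStar d (u j)))‖ₑ ^ 2 := by
    -- The threshold varies with the site; replacing it by the sum over all `k` makes the bound
    -- uniform in `x`.
    gcongr with j
    exact ENNReal.le_tsum (f := fun k : ℤ => ENNReal.ofReal ((2 : ℝ) ^ k) *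
      ‖inner ℂ (planeWave x) (torusMul (highCutoff e (2 ^ k)) (fourierStar d (u j)))‖ₑ ^ 2) k
  calc ENNReal.ofReal w * ∑ j, ‖u j x‖ₑ ^ 2
      ≤ ENNReal.ofReal w * ∑ j, (2 * ‖a j‖ₑ ^ 2 + 2 * ‖b j‖ₑ ^ 2) := by
        gcongr with j
        exact hsq j
    _ = ENNReal.ofReal (w * 2) * ∑ j, ‖a j‖ₑ ^ 2 + ENNReal.ofReal (w * 2) * ∑ j, ‖b j‖ₑ ^ 2 := by
        rw [Finset.sum_add_distrib, ← Finset.mul_sum, ← Finset.mul_sum, mul_add, ← mul_assoc,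
          ← mul_assoc, ENNReal.ofReal_mul hw.le, ENNReal.ofReal_ofNat]
    _ ≤ ENNReal.ofReal (w * 2) * ENNReal.ofReal (C * (32 * w) ^ (s - 1)) +
        ENNReal.ofReal (4⁻¹ * t) * ∑ j, ‖b j‖ₑ ^ 2 := by
        have : w * 2 ≤ 4⁻¹ * t := by linarith
        gcongr
    _ ≤ _ := by
        refine add_le_add (le_of_eq ?_) ?_
        · rw [← ENNReal.ofReal_mul (by positivity)]
          congr 1
          have e1 : w ^ s = w ^ (s - 1) * w := by
            conv_lhs => rw [show s = s - 1 + 1 by ring]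
            rw [Real.rpow_add_one hw.ne']
          rw [Real.mul_rpow (by norm_num) hw.le, e1]
          ring
        · rw [ENNReal.ofReal_mul (by norm_num), mul_assoc, Finset.mul_sum,
            ENNReal.ofReal_inv_of_pos (by norm_num), ENNReal.ofReal_ofNat]
          gcongr

/-- The Cwikel–Lieb–Rozenblum bound for families which are orthonormal in energy. -/
theorem card_le_of_orthonormal_energyMap (e : C(DualTorus d, ℝ)) (he : ∀ p, 0 ≤ e p)
    (hpos : ∀ᵐ p ∂dualHaar d, 0 < e p) {s C : ℝ} (hs : 1 < s) (hC : 0 ≤ C)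
    (hint : ∀ t : ℝ, 0 < t → ∫⁻ p, Set.indicator {p | e p ≤ t}
      (fun p => ENNReal.ofReal (e p)⁻¹) p ∂dualHaar d ≤ ENNReal.ofReal (C * t ^ (s - 1)))
    {ι : Type*} [Fintype ι] {u : ι → LTwo d} (hu : Orthonormal ℂ fun j => energyMap e (u j))
    {W : Lattice d → ℝ} (hW : ∀ x, 0 ≤ W x)
    (hform : ∀ j, ‖energyMap e (u j)‖ₑ ^ 2 ≤ ∑' x, ENNReal.ofReal (W x) * ‖u j x‖ₑ ^ 2)
    (S : Finset (Lattice d)) (hS : ∀ j, ∀ x ∈ S, u j x = 0) :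
    (Fintype.card ι : ℝ≥0∞) ≤ ENNReal.ofReal (4 * C * 32 ^ (s - 1)) *
      ∑' x : {x // x ∉ S}, ENNReal.ofReal (W x ^ s) := by
  set Q := ∑' x : {x // x ∉ S}, ENNReal.ofReal (W x ^ s)
  set β : ι → Lattice d → ℝ≥0∞ := fun j x => ∑' k : ℤ, ENNReal.ofReal ((2 : ℝ) ^ k) *
    ‖inner ℂ (planeWave x) (torusMul (highCutoff e (2 ^ k)) (fourierStar d (u j)))‖ₑ ^ 2 with hβ
  have hnorm : ∀ j, ‖energyMap e (u j)‖ₑ ^ 2 = 1 := fun j => by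
    rw [← ofReal_norm, hu.norm_eq_one]; simp
  have key : (Fintype.card ι : ℝ≥0∞) ≤
      ENNReal.ofReal (2 * C * 32 ^ (s - 1)) * Q + 2⁻¹ * Fintype.card ι := by
    calc (Fintype.card ι : ℝ≥0∞) = ∑ j, ‖energyMap e (u j)‖ₑ ^ 2 := by simp [hnorm]
      _ ≤ ∑ j, ∑' x, ENNReal.ofReal (W x) * ‖u j x‖ₑ ^ 2 := Finset.sum_le_sum fun j _ => hform j
      _ = ∑' x, ENNReal.ofReal (W x) * ∑ j, ‖u j x‖ₑ ^ 2 := by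
          rw [← Summable.tsum_finsetSum fun _ _ => ENNReal.summable]
          simp_rw [Finset.mul_sum]
      _ = ∑' x : {x // x ∉ S}, ENNReal.ofReal (W x) * ∑ j, ‖u j x‖ₑ ^ 2 := by
          refine (tsum_subtype_eq_of_support_subset fun x hx => ?_).symm
          by_contra hxS
          have hxS : x ∈ S := by
            by_contra h
            exact hxS h
          exact hx (by simp [hS _ x hxS])
      _ ≤ ∑' x : {x // x ∉ S}, (ENNReal.ofReal (2 * C * 32 ^ (s - 1)) *
            ENNReal.ofReal (W x ^ s) + 4⁻¹ * ∑ j, β j x) := by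
          refine ENNReal.tsum_le_tsum fun x => ?_
          rw [← ENNReal.ofReal_mul (by positivity)]
          exact ofReal_mul_sum_enorm_sq_le e hpos hs hC hint hu (hW x) x
      _ = ENNReal.ofReal (2 * C * 32 ^ (s - 1)) * Q + 4⁻¹ * ∑' x : {x // x ∉ S}, ∑ j, β j x := by
          rw [ENNReal.tsum_add, ENNReal.tsum_mul_left, ENNReal.tsum_mul_left]
      -- The high parts cost `2 * n / 4 = n / 2`, which the left-hand side absorbs.
      _ ≤ ENNReal.ofReal (2 * C * 32 ^ (s - 1)) * Q + 4⁻¹ * (2 * Fintype.card ι) := by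
          gcongr
          calc ∑' x : {x // x ∉ S}, ∑ j, β j x ≤ ∑' x, ∑ j, β j x :=
                ENNReal.tsum_comp_le_tsum_of_injective Subtype.val_injective _
            _ = ∑ j, ∑' x, β j x := Summable.tsum_finsetSum fun _ _ => ENNReal.summable
            _ ≤ ∑ j, 2 * ‖energyMap e (u j)‖ₑ ^ 2 :=
                Finset.sum_le_sum fun j _ => tsum_tsum_enorm_inner_high_sq_le e he (u j)
            _ = 2 * Fintype.card ι := by simp [hnorm, mul_comm]
      _ = _ := by
          rw [← mul_assoc]
          congr 2
          rw [show (4 : ℝ≥0∞) = 2 * 2 by norm_num,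
            ENNReal.mul_inv (Or.inl two_ne_zero) (Or.inl ENNReal.ofNat_ne_top), mul_assoc,
            ENNReal.inv_mul_cancel two_ne_zero ENNReal.ofNat_ne_top, mul_one]
  have h4 : ENNReal.ofReal (4 * C * 32 ^ (s - 1)) * Q =
      2 * (ENNReal.ofReal (2 * C * 32 ^ (s - 1)) * Q) := by
    rw [← mul_assoc, show (2 : ℝ≥0∞) = ENNReal.ofReal 2 by simp, ← ENNReal.ofReal_mul (by norm_num)]
    congr 2
    ring
  rw [h4]
  rcases eq_or_ne (ENNReal.ofReal (2 * C * 32 ^ (s - 1)) * Q) ⊤ with hQ | hQ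
  · rw [hQ]; simp
  lift ENNReal.ofReal (2 * C * 32 ^ (s - 1)) * Q to NNReal using hQ with q
  have key' : (Fintype.card ι : NNReal) ≤ q + 2⁻¹ * Fintype.card ι := by
    rw [← ENNReal.coe_le_coe]
    push_cast
    exact key
  have : (Fintype.card ι : NNReal) ≤ 2 * q := by
    rw [← NNReal.coe_le_coe] at key' ⊢
    push_cast at key' ⊢
    linarith
  exact_mod_cast this

/-- The Cwikel–Lieb–Rozenblum bound, with the potential omitted at finitely many points. -/
theorem boundStates_le (e : C(DualTorus d, ℝ)) (he : ∀ p, 0 ≤ e p)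
    (hpos : ∀ᵐ p ∂dualHaar d, 0 < e p) {s C : ℝ} (hs : 1 < s) (hC : 0 ≤ C)
    (hint : ∀ t : ℝ, 0 < t → ∫⁻ p, Set.indicator {p | e p ≤ t}
      (fun p => ENNReal.ofReal (e p)⁻¹) p ∂dualHaar d ≤ ENNReal.ofReal (C * t ^ (s - 1)))
    {W : Lattice d → ℝ} (hW : ∀ x, 0 ≤ W x) (hWb : Memℓp W ∞) (S : Finset (Lattice d)) :
    (boundStates e W : ℝ≥0∞) ≤ S.card + ENNReal.ofReal (4 * C * 32 ^ (s - 1)) *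
      ∑' x : {x // x ∉ S}, ENNReal.ofReal (W x ^ s) := by
  set M := negSpectralSubspace (schrodinger e W) with hM
  set B := (S.card : ℝ≥0∞) + ENNReal.ofReal (4 * C * 32 ^ (s - 1)) *
      ∑' x : {x // x ∉ S}, ENNReal.ofReal (W x ^ s) with hB
  -- Testing finite `n` also covers infinite rank, which is not excluded beforehand.
  suffices h : ∀ n : ℕ, (n : ℕ∞) ≤ boundStates e W → (n : ℝ≥0∞) ≤ B by
    rcases eq_or_ne (boundStates e W) ⊤ with htop | htop
    · rw [htop] at h ⊢
      simp only [le_top, forall_const] at h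
      rw [ENat.toENNReal_top]
      exact ENNReal.le_of_forall_nnreal_lt fun r _ => by
        obtain ⟨n, hn⟩ := exists_nat_ge r
        exact le_trans (by exact_mod_cast hn) (h n)
    · obtain ⟨n, hn⟩ := ENat.ne_top_iff_exists.1 htop
      rw [← hn]
      simpa using h n hn.le
  intro n hn
  have hn' : (n : Cardinal) ≤ Module.rank ℂ M := by
    simpa [boundStates, numNegative] using hn
  obtain ⟨g, hg⟩ := Module.le_rank_iff_exists_linearMap.1 hn'
  set G : (Fin n → ℂ) →ₗ[ℂ] LTwo d := M.subtype ∘ₗ g with hG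
  have hGinj : Function.Injective G := Subtype.val_injective.comp hg
  -- Restriction to `S` has rank at most `|S|`, so at least `n - |S|` dimensions vanish on `S`.
  let R : (Fin n → ℂ) →ₗ[ℂ] (S → ℂ) :=
    { toFun := fun v x => G v x
      map_add' := fun v w => by ext x; simp
      map_smul' := fun c v => by ext x; simp }
  set T : (LinearMap.ker R) →ₗ[ℂ] Lp ℂ 2 (dualHaar d) :=
    (energyMap e).toLinearMap ∘ₗ G ∘ₗ (LinearMap.ker R).subtype with hT
  have hTinj : Function.Injective T :=
    (energyMap_injective hpos).comp (hGinj.comp Subtype.val_injective)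
  have hfin : Module.finrank ℂ (LinearMap.range T) = Module.finrank ℂ (LinearMap.ker R) :=
    LinearMap.finrank_range_of_inj hTinj
  have hdim : n ≤ S.card + Module.finrank ℂ (LinearMap.range T) := by
    have h1 := R.finrank_range_add_finrank_ker
    have h2 := (LinearMap.range R).finrank_le
    simp only [Module.finrank_fintype_fun_eq_card, Fintype.card_fin, Fintype.card_coe] at h1 h2
    omega
  -- Pulled back through `T`, this basis is a family orthonormal in energy.
  let b := stdOrthonormalBasis ℂ (LinearMap.range T)
  have hex : ∀ j, ∃ v, T v = b j := fun j => (b j).2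
  choose v hv using hex
  have hmem : ∀ j, G (v j) ∈ M := fun j => (g (v j)).2
  have hort : Orthonormal ℂ fun j => energyMap e (G (v j)) := by
    have : (fun j => energyMap e (G (v j))) = fun j => (b j : Lp ℂ 2 (dualHaar d)) :=
      funext fun j => hv j
    rw [this]
    exact b.orthonormal.comp_linearIsometry (LinearMap.range T).subtypeₗᵢ
  have := card_le_of_orthonormal_energyMap e he hpos hs hC hint hort hW
    (fun j => enorm_energyMap_sq_le he hW hWb (hmem j)) S
    (fun j x hx => congrFun (LinearMap.mem_ker.1 (v j).2) ⟨x, hx⟩)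
  rw [Fintype.card_fin] at this
  calc (n : ℝ≥0∞) ≤ (S.card : ℝ≥0∞) + (Module.finrank ℂ (LinearMap.range T) : ℝ≥0∞) := by
        exact_mod_cast hdim
    _ ≤ B := by rw [hB]; gcongr

end CLR

/-! ### The semi-classical count -/

section Semiclassical

variable {d : ℕ}

/-- Phase space bound for the semi-classical counting function. -/
theorem semiclassicalStates_le (e : C(DualTorus d, ℝ)) (he : ∀ p, 0 ≤ e p) {s C : ℝ} (hC : 0 ≤ C)
    (hvol : ∀ t : ℝ, 0 < t → dualHaar d {p | e p ≤ t} ≤ ENNReal.ofReal (C * t ^ s))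
    {W : Lattice d → ℝ} (hW : ∀ x, 0 ≤ W x) (S : Finset (Lattice d)) :
    semiclassicalStates e W ≤ S.card + ENNReal.ofReal C *
      ∑' x : {x // x ∉ S}, ENNReal.ofReal (W x ^ s) := by
  have hterm : ∀ x, ∫⁻ p, Set.indicator {p | e p - W x < 0} (fun _ => (1 : ℝ≥0∞)) p ∂dualHaar d =
      dualHaar d {p | e p - W x < 0} := fun x => by
    have hm : MeasurableSet {p | e p - W x < 0} :=
      measurableSet_lt (by fun_prop) measurable_const
    rw [lintegral_indicator_const hm, one_mul]
  simp_rw [semiclassicalStates, hterm]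
  rw [← ENNReal.sum_add_tsum_compl S, ← ENNReal.tsum_mul_left]
  refine add_le_add ?_ (ENNReal.tsum_le_tsum fun x => ?_)
  -- Each site contributes at most the total mass 1 of the torus.
  · calc ∑ x ∈ S, dualHaar d {p | e p - W x < 0} ≤ ∑ x ∈ S, 1 :=
          Finset.sum_le_sum fun x _ => prob_le_one
      _ = S.card := by simp
  · rw [← ENNReal.ofReal_mul hC]
    rcases (hW x).eq_or_lt with h | h
    · have : {p | e p - W x < 0} = ∅ := by
        ext p
        simpa [← h] using he p
      rw [this]; simp
    · refine (measure_mono fun p hp => ?_).trans (hvol _ h)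
      simp only [Set.mem_ofPred_eq] at hp ⊢
      linarith

end Semiclassical

/-! ### The strong coupling limit -/

section Asymptotics

/-- A function which is bounded by the number of points of a finite set plus `lam ^ s` times a
tail of a fixed convergent sum is `o(lam ^ s)`. -/
theorem tendsto_rpow_neg_mul_of_le {ι : Type*} {F : ℝ → ℝ≥0∞} {V : ι → ℝ} (hV : ∀ x, 0 ≤ V x)
    {s C : ℝ} (hs : 0 < s) (hsum : Summable fun x => V x ^ s)
    (hF : ∀ lam : ℝ, 0 < lam → ∀ S : Finset ι, F lam ≤ S.card + ENNReal.ofReal C *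
      ∑' x : {x // x ∉ S}, ENNReal.ofReal ((lam * V x) ^ s)) :
    Tendsto (fun lam : ℝ => ENNReal.ofReal (lam ^ (-s)) * F lam) atTop (𝓝 0) := by
  rw [ENNReal.tendsto_nhds_zero]
  intro ε hε
  have hfin : ∑' x, ENNReal.ofReal (V x ^ s) ≠ ⊤ := by
    rw [← ENNReal.ofReal_tsum_of_nonneg (fun x => Real.rpow_nonneg (hV x) s) hsum]
    exact ENNReal.ofReal_ne_top
  have htail : Tendsto (fun S : Finset ι => ENNReal.ofReal C *
      ∑' x : {x // x ∉ S}, ENNReal.ofReal (V x ^ s)) atTop (𝓝 0) := by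
    simpa using ENNReal.Tendsto.const_mul (a := ENNReal.ofReal C)
      (ENNReal.tendsto_tsum_compl_atTop_zero hfin) (Or.inr ENNReal.ofReal_ne_top)
  have hε2 : 0 < ε / 2 := ENNReal.half_pos hε.ne'
  -- `S` is fixed by the tail before `lam` grows; this works because the rescaled tail is
  -- independent of `lam`.
  obtain ⟨S, hS⟩ := ((ENNReal.tendsto_nhds_zero.1 htail) _ hε2).exists
  have hcard : Tendsto (fun lam : ℝ => ENNReal.ofReal (lam ^ (-s)) * (S.card : ℝ≥0∞)) atTop
      (𝓝 0) := by
    have h1 : Tendsto (fun lam : ℝ => ENNReal.ofReal (lam ^ (-s))) atTop (𝓝 0) := by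
      simpa using ENNReal.tendsto_ofReal (tendsto_rpow_neg_atTop hs)
    simpa using ENNReal.Tendsto.mul_const (b := (S.card : ℝ≥0∞)) h1
      (Or.inr (ENNReal.natCast_ne_top _))
  filter_upwards [eventually_gt_atTop 0, (ENNReal.tendsto_nhds_zero.1 hcard) _ hε2] with lam h0 h1
  have hscale : ENNReal.ofReal (lam ^ (-s)) *
      ∑' x : {x // x ∉ S}, ENNReal.ofReal ((lam * V x) ^ s) =
      ∑' x : {x // x ∉ S}, ENNReal.ofReal (V x ^ s) := by
    rw [← ENNReal.tsum_mul_left]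
    refine tsum_congr fun x => ?_
    rw [← ENNReal.ofReal_mul (by positivity), Real.mul_rpow h0.le (hV x), ← mul_assoc,
      ← Real.rpow_add h0, neg_add_cancel, Real.rpow_zero, one_mul]
  calc ENNReal.ofReal (lam ^ (-s)) * F lam
      ≤ ENNReal.ofReal (lam ^ (-s)) * (S.card + ENNReal.ofReal C *
        ∑' x : {x // x ∉ S}, ENNReal.ofReal ((lam * V x) ^ s)) := by
        gcongr
        exact hF lam h0 S
    _ = ENNReal.ofReal (lam ^ (-s)) * S.card + ENNReal.ofReal C *
        ∑' x : {x // x ∉ S}, ENNReal.ofReal (V x ^ s) := by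
        rw [mul_add, mul_left_comm, hscale]
    _ ≤ ε / 2 + ε / 2 := add_le_add h1 hS
    _ = ε := ENNReal.add_halves ε

end Asymptotics

theorem lemma1p6 {d : ℕ} (hd : 3 ≤ d) (e : C(DualTorus d, ℝ)) (he : IsAdmissible e)
    (V : Lattice d → ℝ) (hV_nonneg : ∀ x, 0 ≤ V x) (hV : Memℓp V ((d : ℝ≥0∞) / 2)) :
    Tendsto (fun lam : ℝ =>
        ENNReal.ofReal (lam ^ (-((d : ℝ) / 2))) * (boundStates e (lam • V) : ℝ≥0∞))
      atTop (𝓝 0) ∧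
    Tendsto (fun lam : ℝ =>
        ENNReal.ofReal (lam ^ (-((d : ℝ) / 2))) * semiclassicalStates e (lam • V))
      atTop (𝓝 0) := by
  have hd' : (3 : ℝ) ≤ d := by exact_mod_cast hd
  -- The dimension enters here: `1 / e` is integrable at the minima because `d / 2 > 1`.
  have hs : 1 < (d : ℝ) / 2 := by linarith
  have hs0 : 0 < (d : ℝ) / 2 := by linarith
  have htoReal : ((d : ℝ≥0∞) / 2).toReal = (d : ℝ) / 2 := by simp
  have hsum : Summable fun x => V x ^ ((d : ℝ) / 2) := by
    have := hV.summable (by rwa [htoReal])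
    simpa only [htoReal, Real.norm_eq_abs, abs_of_nonneg (hV_nonneg _)] using this
  have hVb : Memℓp V ∞ := hV.of_exponent_ge le_top
  obtain ⟨C, hC, hvol⟩ := he.exists_measure_sublevel_le
  obtain ⟨C', hC', hint⟩ :=
    exists_lintegral_inv_sublevel_le e.continuous.measurable hs hC hvol
  -- The zero set lies in every sublevel set, whose measures tend to 0.
  have hpos : ∀ᵐ p ∂dualHaar d, 0 < e p := by
    rw [ae_iff]
    simp only [not_lt]
    have hlim : Tendsto (fun t : ℝ => ENNReal.ofReal (C * t ^ ((d : ℝ) / 2))) (𝓝[>] 0) (𝓝 0) := by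
      have h1 : Tendsto (fun t : ℝ => C * t ^ ((d : ℝ) / 2)) (𝓝[>] 0) (𝓝 0) := by
        have := ((Real.continuousAt_rpow_const 0 ((d : ℝ) / 2) (Or.inr hs0.le)).tendsto.const_mul
          C).mono_left (nhdsWithin_le_nhds (s := Set.Ioi 0))
        simpa [Real.zero_rpow hs0.ne'] using this
      simpa using ENNReal.tendsto_ofReal h1
    refine le_antisymm (ge_of_tendsto hlim ?_) zero_le
    filter_upwards [self_mem_nhdsWithin] with t ht
    exact (measure_mono fun p (hp : e p ≤ 0) => hp.trans (le_of_lt ht)).trans (hvol t ht)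
  have hWnn : ∀ lam : ℝ, 0 < lam → ∀ x, 0 ≤ (lam • V) x := fun lam h x =>
    mul_nonneg h.le (hV_nonneg x)
  exact ⟨tendsto_rpow_neg_mul_of_le hV_nonneg hs0 hsum fun lam h S =>
      boundStates_le e he.nonneg hpos hs hC' hint (hWnn lam h) (hVb.const_smul lam) S,
    tendsto_rpow_neg_mul_of_le hV_nonneg hs0 hsum fun lam h S =>
      semiclassicalStates_le e he.nonneg hC hvol (hWnn lam h) S⟩
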